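/- Let $\Gamma=(V,E)$ be a finite simple graph with adjacency matrix $A$. Call $\Gamma$ *strongly walk-regular* if for some integer $\ell\ge 2$ the power $A^\ell$ is a linear combination of $I$, $A$ and the all-ones matrix $J$, and *genuine* strongly walk-regular if, moreover, $\Gamma$ is connected and $A$ has exactly four distinct eigenvalues (such a graph is regular, and its largest eigenvalue $k$ is its valency). Let $\mathcal A=\{(x,y)\in V\times V : \{x,y\}\in E\}$ be the set of arcs; for $a=(x,y)$ put $o(a)=x$, $t(a)=y$ and $a^{-1}=(y,x)$. Let $d\in\mathbb C^{V\times\mathcal A}$ with $d_{x,a}=\frac{1}{\sqrt{\deg x}}\,\delta_{x,t(a)}$, let $R\in\mathbb C^{\mathcal A\times\mathcal A}$ with $R_{a,b}=\delta_{a,b^{-1}}$, and let $U=R(2d^*d-I)$ be the time evolution matrix of the Grover walk on $\Gamma$. The graph $\Gamma$ is *periodic* if $U^\tau=I$ for some integer $\tau\ge 1$. **Corollary.** Let $\Gamma$ be a genuine strongly walk-regular graph with distinct eigenvalues $k>\theta_1>\theta_2>\theta_3$. Then $\Gamma$ is periodic if and only if $(\theta_1,\theta_2,\theta_3)=\left(\frac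 k2,0,-\frac k2\right)$. In that case, $U^{12}=I$. -/

import Mathlib

open scoped Matrix

namespace GroverWalk

noncomputable section

variable {V : Type*} [Fintype V] [DecidableEq V]

/-- The boundary matrix `d ∈ ℂ^(V × 𝒜)`, `d_{x,a} = δ_{x,t(a)} / √(deg x)`. The symmetric arcs of `G`
are its darts; a dart `a` has origin `a.fst`, terminus `a.snd` and inverse `a.symm`. -/
def boundary (G : SimpleGraph V) [DecidableRel G.Adj] : Matrix V G.Dart ℂ :=
  Matrix.of fun x a => if x = a.snd then (1 / Real.sqrt (G.degree x) : ℂ) else 0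

/-- The shift matrix `R ∈ ℂ^(𝒜 × 𝒜)`, `R_{a,b} = δ_{a,b⁻¹}`. -/
def shift (G : SimpleGraph V) : Matrix G.Dart G.Dart ℂ :=
  Matrix.of fun a b => if a = b.symm then 1 else 0

/-- The time evolution matrix `U = R (2 d* d - I)` of the Grover walk on `G`. -/
def timeEvolution (G : SimpleGraph V) [DecidableRel G.Adj] : Matrix G.Dart G.Dart ℂ :=
  shift G * ((2 : ℂ) • ((boundary G)ᴴ * boundary G) - 1)

/-- `G` is periodic: `U ^ τ = I` for some positive integer `τ`. -/
def IsPeriodic (G : SimpleGraph V) [DecidableRel G.Adj] : Prop :=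
  ∃ τ : ℕ, 1 ≤ τ ∧ timeEvolution G ^ τ = 1

/-- `G` is strongly `ℓ`-walk-regular, for `ℓ ≥ 2`: the power `A ^ ℓ` of the adjacency matrix is a
linear combination of `I`, `A` and the all-ones matrix `J`. -/
def IsStronglyWalkRegularOfLength (G : SimpleGraph V) [DecidableRel G.Adj] (ℓ : ℕ) : Prop :=
  2 ≤ ℓ ∧ ∃ a b c : ℝ, G.adjMatrix ℝ ^ ℓ =
    a • (1 : Matrix V V ℝ) + b • G.adjMatrix ℝ + c • Matrix.of fun _ _ => (1 : ℝ)

/-- `G` is strongly walk-regular: strongly `ℓ`-walk-regular for some `ℓ ≥ 2`. -/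
def IsStronglyWalkRegular (G : SimpleGraph V) [DecidableRel G.Adj] : Prop :=
  ∃ ℓ : ℕ, IsStronglyWalkRegularOfLength G ℓ

/-- `G` is a genuine strongly walk-regular graph: a connected strongly walk-regular graph whose
adjacency matrix has exactly four distinct eigenvalues. -/
structure IsGenuineStronglyWalkRegular (G : SimpleGraph V) [DecidableRel G.Adj] : Prop where
  connected : G.Connected
  stronglyWalkRegular : IsStronglyWalkRegular G
  four_eigenvalues : (spectrum ℝ (G.adjMatrix ℝ)).ncard = 4

end

end GroverWalk

/-!
The walk and the graph are linked by the matrix `T = d R d*`, which is `A / k` for a `k`-regular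
graph: since `d d* = I`, an eigenvalue `z` of `U` is `±1` or satisfies `z + z⁻¹ = 2 μ` with `μ` an
eigenvalue of `T`, and conversely each eigenvalue of `T` arises in this way.

If the walk is periodic, then all such `z` are roots of unity, so the numbers `xᵢ = 2 θᵢ / k` are
algebraic integers in `[-2, 2)`. As `2, x₁, x₂, x₃` are all the eigenvalues of a rational matrix,
the elementary symmetric functions of `x₁, x₂, x₃` are integers. Strong walk-regularity makes
`x₁, x₂, x₃` roots of a trinomial `x ^ ℓ - b x - a`; convexity forces `ℓ` to be odd and bounds
`x₁ + x₂ + x₃`, and integrality then forces `x₁ + x₂ + x₃ = 0`. Counting closed walks of lengths one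
and two, i.e. evaluating `tr A` and `tr A²` through the multiplicities, excludes irrational `xᵢ`, so
that `(x₁, x₂, x₃) = (1, 0, -1)`.

Conversely, if `2 μ ∈ {2, 1, 0, -1}` for all eigenvalues `μ` of `T`, then every eigenvalue of `U` is
a twelfth root of unity; as `U` is unitary, hence diagonalizable, `U ^ 12 = I`.
-/

namespace GroverWalk

section MatrixSpectrum

theorem mem_spectrum_iff_exists_mulVec_eq_smul {n K : Type*} [Fintype n] [DecidableEq n] [Field K]
    {M : Matrix n n K} {μ : K} : μ ∈ spectrum K M ↔ ∃ v : n → K, v ≠ 0 ∧ M *ᵥ v = μ • v := by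
  rw [← Matrix.spectrum_toLin', ← Module.End.hasEigenvalue_iff_mem_spectrum]
  constructor
  · intro h
    obtain ⟨v, hv⟩ := h.exists_hasEigenvector
    exact ⟨v, hv.2, by simpa using hv.apply_eq_smul⟩
  · rintro ⟨v, hv, h⟩
    exact Module.End.hasEigenvalue_of_hasEigenvector
      ⟨Module.End.mem_eigenspace_iff.mpr (by simpa using h), hv⟩

theorem pow_eq_of_mulVec_eq_smul {n K : Type*} [Fintype n] [DecidableEq n] [Field K]
    {A B : Matrix n n K} {ℓ : ℕ} {a b t : K} {v : n → K} (h : A ^ ℓ = a • 1 + b • A + B)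
    (hv : v ≠ 0) (hAv : A *ᵥ v = t • v) (hBv : B *ᵥ v = 0) : t ^ ℓ = b * t + a := by
  have hpow : A ^ ℓ *ᵥ v = t ^ ℓ • v := by
    clear h
    induction ℓ with
    | zero => simp
    | succ j ih => rw [pow_succ', ← Matrix.mulVec_mulVec, ih, Matrix.mulVec_smul, hAv, smul_smul,
        pow_succ]
  rw [h, Matrix.add_mulVec, Matrix.add_mulVec, Matrix.smul_mulVec, Matrix.smul_mulVec, hAv, hBv,
    Matrix.one_mulVec, add_zero, smul_smul, ← add_smul] at hpow
  exact (smul_left_injective K hv hpow).symm.trans (add_comm _ _)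

theorem spectrum_smul_eq_image {K A : Type*} [Field K] [Ring A] [Algebra K A] {s : K} (hs : s ≠ 0)
    (a : A) : spectrum K (s • a) = (s * ·) '' spectrum K a :=
  spectrum.unit_smul_eq_smul a (Units.mk0 s hs)

theorem pow_eq_one_of_mem_spectrum {K A : Type*} [Field K] [Ring A] [Algebra K A] {a : A} {n : ℕ}
    (ha : a ^ n = 1) {z : K} (hz : z ∈ spectrum K a) : z ^ n = 1 := by
  have hz' := spectrum.pow_mem_pow a n hz
  rw [ha] at hz'
  rcases subsingleton_or_nontrivial A with h | h
  · simp at hz'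
  · simpa using hz'

theorem pow_eq_one_of_forall_mem_spectrum {A : Type*} [CStarAlgebra A] (a : A) [IsStarNormal a]
    {n : ℕ} (h : ∀ z ∈ spectrum ℂ a, z ^ n = 1) : a ^ n = 1 := by
  rw [← cfc_pow_id (R := ℂ) a n, cfc_congr (g := fun _ => 1) h, cfc_const_one ℂ a]

open Polynomial in
theorem exists_mul_eq_one_and_add_eq {K : Type*} [Field K] [IsAlgClosed K] (t : K) :
    ∃ z w : K, z * w = 1 ∧ z + w = t := by
  have hdeg : (X ^ 2 - C t * X + 1 : K[X]).degree = 2 := by compute_degree!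
  obtain ⟨z, hz⟩ := IsAlgClosed.exists_root _ (hdeg.trans_ne two_ne_zero)
  refine ⟨z, t - z, ?_, by ring⟩
  simp only [IsRoot.def, eval_add, eval_sub, eval_mul, eval_pow, eval_X, eval_C, eval_one] at hz
  linear_combination -hz

variable {n : Type*} [Fintype n] [DecidableEq n]

theorem spectrum_map_algebraMap {F K : Type*} [Field F] [Field K] [Algebra F K] {M : Matrix n n F}
    (hM : M.charpoly.Splits) :
    spectrum K (M.map (algebraMap F K)) = algebraMap F K '' spectrum F M := by
  ext μ
  have hmap : (M.charpoly.map (algebraMap F K)) ≠ 0 := ((Matrix.charpoly_monic M).map _).ne_zero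
  simp only [Set.mem_image, Matrix.mem_spectrum_iff_isRoot_charpoly, Matrix.charpoly_map,
    ← Polynomial.mem_roots hmap, ← Polynomial.mem_roots (Matrix.charpoly_monic M).ne_zero,
    hM.roots_map, Multiset.mem_map]

theorem trace_pow_eq_sum_eigenvalues_pow {𝕜 : Type*} [RCLike 𝕜] {A : Matrix n n 𝕜}
    (hA : A.IsHermitian) (j : ℕ) : (A ^ j).trace = ∑ i, (hA.eigenvalues i : 𝕜) ^ j := by
  conv_lhs => rw [hA.spectral_theorem, ← map_pow, Unitary.conjStarAlgAut_apply,
    Matrix.trace_mul_comm, ← mul_assoc]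
  simp [Matrix.trace, Matrix.diagonal_pow]

theorem exists_trace_pow_eq_sum {A : Matrix n n ℝ} (hA : A.IsHermitian) {S : Finset ℝ}
    (hS : spectrum ℝ A = S) : ∃ m : ℝ → ℕ, (∀ t ∈ S, 0 < m t) ∧
      ∀ j : ℕ, (A ^ j).trace = ∑ t ∈ S, m t * t ^ j := by
  have himage : Finset.univ.image hA.eigenvalues = S := by
    rw [← Finset.coe_inj, Finset.coe_image, Finset.coe_univ, Set.image_univ,
      ← hA.spectrum_real_eq_range_eigenvalues, hS]
  refine ⟨fun t => (Finset.univ.filter fun i => hA.eigenvalues i = t).card, fun t ht => ?_,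
    fun j => ?_⟩
  · obtain ⟨i, -, hi⟩ := Finset.mem_image.mp (himage ▸ ht)
    exact Finset.card_pos.mpr ⟨i, by simpa using hi⟩
  · simp only [trace_pow_eq_sum_eigenvalues_pow hA, RCLike.ofReal_real_eq_id, id_eq,
      Finset.sum_comp (· ^ j) hA.eigenvalues, himage, nsmul_eq_mul]

end MatrixSpectrum

section Rationality

open Polynomial UniqueFactorizationMonoid

theorem exists_int_of_isIntegral {x : ℝ} (hx : IsIntegral ℤ x) {q : ℚ} (h : x = q) :
    ∃ n : ℤ, x = n := by
  have : IsIntegral ℤ q := by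
    rw [← isIntegral_algebraMap_iff (algebraMap ℚ ℝ).injective]
    simpa [← h] using hx
  obtain ⟨n, rfl⟩ := IsIntegrallyClosed.isIntegral_iff.mp this
  exact ⟨n, by simpa using h⟩

theorem exists_map_eq_prod_aroots {F K : Type*} [Field F] [PerfectField F] [Field K]
    [DecidableEq K] [Algebra F K] {P : F[X]} (hP : P ≠ 0)
    (hsplits : (P.map (algebraMap F K)).Splits) :
    ∃ Q : F[X], Q.map (algebraMap F K) = ∏ x ∈ (P.aroots K).toFinset, (X - C x) := by
  classical
  have hP' : P.map (algebraMap F K) ≠ 0 := Polynomial.map_ne_zero hP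
  have hmonic : (radical P).Monic :=
    monic_prod_of_monic _ _ fun p hp =>
      ((Polynomial.mem_normalizedFactors_iff hP).mp (mem_primeFactors.mp hp)).2.1
  have hsep : (radical P).Separable := PerfectField.separable_iff_squarefree.mpr squarefree_radical
  have hroots : (radical P).aroots K = (P.aroots K).toFinset.val := by
    rw [Multiset.Nodup.ext (nodup_roots hsep.map) (Finset.nodup _)]
    intro x
    rw [Finset.mem_val, Multiset.mem_toFinset, mem_aroots, mem_aroots]
    refine and_congr (iff_of_true radical_ne_zero hP) ⟨fun hx => ?_, fun hx => ?_⟩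
    · exact aeval_eq_zero_of_dvd_aeval_eq_zero radical_dvd_self hx
    · obtain ⟨j, hdvd⟩ := exists_dvd_radical_self_pow hP
      have hpow := aeval_eq_zero_of_dvd_aeval_eq_zero hdvd hx
      rw [map_pow] at hpow
      exact eq_zero_of_pow_eq_zero hpow
  refine ⟨radical P, ?_⟩
  have hprod := (hsplits.of_dvd hP' (Polynomial.map_dvd _ radical_dvd_self)).eq_prod_roots_of_monic
    (hmonic.map _)
  rw [hprod, ← aroots_def, hroots]
  rfl

theorem exists_symmetric_functions_of_map_eq {F K : Type*} [Field F] [Field K] [Algebra F K]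
    {Q : F[X]} {d : F} {x₁ x₂ x₃ : K} (hQ : Q.map (algebraMap F K) =
      (X - C (algebraMap F K d)) * ((X - C x₁) * (X - C x₂) * (X - C x₃))) :
    ∃ s₁ s₂ s₃ : F, x₁ + x₂ + x₃ = algebraMap F K s₁ ∧
      x₁ * x₂ + x₁ * x₃ + x₂ * x₃ = algebraMap F K s₂ ∧ x₁ * x₂ * x₃ = algebraMap F K s₃ := by
  have hcubic : (Q /ₘ (X - C d)).map (algebraMap F K) = X ^ 3 - C (x₁ + x₂ + x₃) * X ^ 2
      + C (x₁ * x₂ + x₁ * x₃ + x₂ * x₃) * X - C (x₁ * x₂ * x₃) := by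
    rw [map_divByMonic _ (monic_X_sub_C d), hQ, Polynomial.map_sub, map_X, map_C,
      mul_divByMonic_cancel_left _ (monic_X_sub_C _)]
    simp only [map_add, map_mul]
    ring
  have hcoeff (j : ℕ) := congrArg (coeff · j) hcubic
  simp only [coeff_map, coeff_sub, coeff_add, coeff_C_mul, coeff_X_pow, coeff_X, coeff_C] at hcoeff
  refine ⟨-(Q /ₘ (X - C d)).coeff 2, (Q /ₘ (X - C d)).coeff 1, -(Q /ₘ (X - C d)).coeff 0,
    ?_, ?_, ?_⟩
  · simp [hcoeff]
  · simp [hcoeff]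
  · simp [hcoeff]

theorem exists_int_symmetric_functions {n : Type*} [Fintype n] [DecidableEq n] {M : Matrix n n ℚ}
    (hM : (M.map (algebraMap ℚ ℝ)).charpoly.Splits) {d : ℚ} {x₁ x₂ x₃ : ℝ} (h01 : x₁ < d)
    (h12 : x₂ < x₁) (h23 : x₃ < x₂)
    (hspec : spectrum ℝ (M.map (algebraMap ℚ ℝ)) = {(d : ℝ), x₁, x₂, x₃})
    (hi₁ : IsIntegral ℤ x₁) (hi₂ : IsIntegral ℤ x₂) (hi₃ : IsIntegral ℤ x₃) :
    ∃ p q r : ℤ, x₁ + x₂ + x₃ = p ∧ x₁ * x₂ + x₁ * x₃ + x₂ * x₃ = q ∧ x₁ * x₂ * x₃ = r := by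
  classical
  have hne := (Matrix.charpoly_monic M).ne_zero
  have hroots : (M.charpoly.aroots ℝ).toFinset = {(d : ℝ), x₁, x₂, x₃} := by
    rw [← Finset.coe_inj, Finset.coe_insert, Finset.coe_insert, Finset.coe_insert,
      Finset.coe_singleton, ← hspec]
    ext x
    rw [Finset.mem_coe, Multiset.mem_toFinset, mem_aroots, and_iff_right hne,
      Matrix.mem_spectrum_iff_isRoot_charpoly, Matrix.charpoly_map, IsRoot, eval_map_algebraMap]
  obtain ⟨Q, hQ⟩ := exists_map_eq_prod_aroots (K := ℝ) hne (by rwa [← Matrix.charpoly_map])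
  rw [hroots, Finset.prod_insert (by grind), Finset.prod_insert (by grind),
    Finset.prod_insert (by grind), Finset.prod_singleton, ← mul_assoc (X - C x₁)] at hQ
  obtain ⟨s₁, s₂, s₃, hs₁, hs₂, hs₃⟩ := exists_symmetric_functions_of_map_eq hQ
  obtain ⟨p, hp⟩ := exists_int_of_isIntegral ((hi₁.add hi₂).add hi₃) hs₁
  obtain ⟨q, hq⟩ :=
    exists_int_of_isIntegral (((hi₁.mul hi₂).add (hi₁.mul hi₃)).add (hi₂.mul hi₃)) hs₂
  obtain ⟨r, hr⟩ := exists_int_of_isIntegral ((hi₁.mul hi₂).mul hi₃) hs₃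
  exact ⟨p, q, r, hp, hq, hr⟩

end Rationality

section Trinomial

variable {ℓ : ℕ} {a b x₁ x₂ x₃ : ℝ}

open Polynomial in
theorem card_le_three_of_forall_pow_eq (hℓ : 2 ≤ ℓ) {S : Finset ℝ}
    (hS : ∀ x ∈ S, x ^ ℓ = b * x + a) : S.card ≤ 3 := by
  set p : ℝ[X] := X ^ ℓ - (C b * X + C a) with hp
  have hp₀ : p ≠ 0 := by
    have hdeg : (C b * X + C a).degree < (X ^ ℓ : ℝ[X]).degree := by
      rw [degree_X_pow]
      exact degree_linear_le.trans_lt (by exact_mod_cast hℓ)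
    exact ((monic_X_pow ℓ).sub_of_left hdeg).ne_zero
  have hp₂ : derivative (derivative p) = C ((ℓ : ℝ) * (ℓ - 1 : ℕ)) * X ^ (ℓ - 2) := by
    simp [hp, derivative_X_pow, mul_assoc, Nat.sub_sub]
  have hroots₂ : (derivative (derivative p)).roots.toFinset ⊆ {0} := by
    intro x hx
    have hx : (derivative (derivative p)).eval x = 0 := by
      simpa using isRoot_of_mem_roots (Multiset.mem_toFinset.mp hx)
    have hℓ₁ : ((ℓ - 1 : ℕ) : ℝ) ≠ 0 := by exact_mod_cast (by omega : ℓ - 1 ≠ 0)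
    have hℓ₀ : (ℓ : ℝ) ≠ 0 := by exact_mod_cast (by omega : ℓ ≠ 0)
    rw [hp₂, eval_mul, eval_C, eval_pow, eval_X] at hx
    simpa using eq_zero_of_pow_eq_zero
      ((mul_eq_zero.mp hx).resolve_left (mul_ne_zero hℓ₀ hℓ₁))
  calc S.card ≤ p.roots.toFinset.card := Finset.card_le_card fun x hx => by
        rw [Multiset.mem_toFinset, mem_roots hp₀]
        simp [hp, hS x hx]
    _ ≤ (derivative p).roots.toFinset.card + 1 := card_roots_toFinset_le_derivative p
    _ ≤ (derivative (derivative p)).roots.toFinset.card + 1 + 1 := by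
        grw [card_roots_toFinset_le_derivative (derivative p)]
    _ ≤ 3 := by grw [Finset.card_le_card hroots₂, Finset.card_singleton]

theorem pow_lt_of_between (hℓ : 2 ≤ ℓ) {x y z : ℝ} (hx : 0 ≤ x) (hxy : x < y) (hyz : y < z)
    (h₁ : x ^ ℓ ≤ b * x + a) (h₂ : z ^ ℓ ≤ b * z + a) : y ^ ℓ < b * y + a := by
  have h := (strictConvexOn_pow hℓ).secant_strict_mono_aux1 (Set.mem_Ici.mpr hx)
    (Set.mem_Ici.mpr (by linarith : 0 ≤ z)) hxy hyz
  nlinarith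

theorem pow_lt_of_between_of_even (hℓ : ℓ ≠ 0) (he : Even ℓ) {x y z : ℝ} (hxy : x < y)
    (hyz : y < z) (h₁ : x ^ ℓ ≤ b * x + a) (h₂ : z ^ ℓ ≤ b * z + a) : y ^ ℓ < b * y + a := by
  have h := (he.strictConvexOn_pow hℓ).secant_strict_mono_aux1 (Set.mem_univ x)
    (Set.mem_univ z) hxy hyz
  nlinarith

theorem odd_of_three_roots (hℓ : ℓ ≠ 0) (h₁ : x₁ ^ ℓ = b * x₁ + a) (h₂ : x₂ ^ ℓ = b * x₂ + a)
    (h₃ : x₃ ^ ℓ = b * x₃ + a) (h12 : x₂ < x₁) (h23 : x₃ < x₂) : Odd ℓ := by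
  by_contra h
  exact (pow_lt_of_between_of_even hℓ (Nat.not_odd_iff_even.mp h) h23 h12 h₃.le h₁.le).ne h₂

theorem neg_pow_eq_of_odd (ho : Odd ℓ) {x : ℝ} (h : x ^ ℓ = b * x + a) :
    (-x) ^ ℓ = b * (-x) + -a := by
  rw [ho.neg_pow, h]; ring

/-- All the binomial coefficients of `(u + v) ^ n`, apart from the outermost two, are at least `3`
when `n ≥ 3`. -/
theorem pow_add_pow_add_geom_sum₂_le_add_pow {u v : ℝ} (hu : 0 ≤ u) (hv : 0 ≤ v) (m : ℕ) :
    u ^ (m + 3) + v ^ (m + 3) + 3 * (u * v * ∑ i ∈ Finset.range (m + 2), u ^ i * v ^ (m + 1 - i)) ≤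
      (u + v) ^ (m + 3) := by
  induction m with
  | zero => simp only [Finset.sum_range_succ, Finset.sum_range_zero]; apply le_of_eq; ring
  | succ m ih =>
    set S := ∑ i ∈ Finset.range (m + 2), u ^ i * v ^ (m + 1 - i)
    have hS : ∑ i ∈ Finset.range (m + 3), u ^ i * v ^ (m + 2 - i) = u ^ (m + 2) + v * S :=
      (Commute.all u v).geom_sum₂_succ_eq
    have hle : u ^ (m + 1) ≤ S := by
      simpa using Finset.single_le_sum (f := fun i => u ^ i * v ^ (m + 1 - i))
        (fun i _ => by positivity) (Finset.self_mem_range_succ (m + 1))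
    calc _ = u ^ (m + 4) + v ^ (m + 4) + 3 * (u * v * (u * u ^ (m + 1) + v * S)) := by
          rw [hS]; ring
      _ ≤ u ^ (m + 4) + v ^ (m + 4) + 3 * (u * v * (u * S + v * S)) := by gcongr
      _ ≤ (u ^ (m + 3) + v ^ (m + 3) + 3 * (u * v * S)) * (u + v) := by
          have : 0 ≤ u * v * (u ^ (m + 2) + v ^ (m + 2)) := by positivity
          linear_combination this
      _ ≤ (u + v) ^ (m + 3) * (u + v) := by gcongr
      _ = (u + v) ^ (m + 1 + 3) := by ring

theorem mul_mul_geom_sum₂_eq {u v : ℝ} (huv : u ≠ v) {m : ℕ} (hu : u ^ (m + 2) = b * u - a)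
    (hv : v ^ (m + 2) = b * v - a) :
    u * v * ∑ i ∈ Finset.range (m + 1), u ^ i * v ^ (m - i) = a := by
  have hgeom := (Commute.all u v).geom_sum₂_mul (m + 1)
  rw [Nat.add_sub_cancel] at hgeom
  refine mul_right_cancel₀ (sub_ne_zero.mpr huv) ?_
  linear_combination u * v * hgeom + v * hu - u * hv

theorem add_pow_ge_of_pow_eq (ho : Odd ℓ) (hℓ : 2 ≤ ℓ) {u v : ℝ} (hu₀ : 0 ≤ u) (hv₀ : 0 ≤ v)
    (huv : u ≠ v) (hu : u ^ ℓ = b * u - a) (hv : v ^ ℓ = b * v - a) :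
    b * (u + v) + a ≤ (u + v) ^ ℓ := by
  obtain ⟨m, rfl⟩ : ∃ m, ℓ = m + 3 := ⟨ℓ - 3, by obtain ⟨j, rfl⟩ := ho; omega⟩
  have h := pow_add_pow_add_geom_sum₂_le_add_pow hu₀ hv₀ m
  rw [mul_mul_geom_sum₂_eq huv hu hv, hu, hv] at h
  linarith

theorem const_pos_of_neg_roots (hℓ : 2 ≤ ℓ) (ho : Odd ℓ) (h₂ : x₂ ^ ℓ = b * x₂ + a)
    (h₃ : x₃ ^ ℓ = b * x₃ + a) (h23 : x₃ < x₂) (hx₂ : x₂ < 0) : 0 < a := by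
  by_contra! ha
  refine (pow_lt_of_between hℓ le_rfl (neg_pos.mpr hx₂) (neg_lt_neg h23) ?_
    (neg_pow_eq_of_odd ho h₃).le).ne (neg_pow_eq_of_odd ho h₂)
  rw [zero_pow (by omega)]
  linarith

theorem const_nonneg_of_nonpos_roots (hℓ : 2 ≤ ℓ) (ho : Odd ℓ) (h₂ : x₂ ^ ℓ = b * x₂ + a)
    (h₃ : x₃ ^ ℓ = b * x₃ + a) (h23 : x₃ < x₂) (hx₂ : x₂ ≤ 0) : 0 ≤ a := by
  rcases hx₂.lt_or_eq with hx₂ | rfl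
  · exact (const_pos_of_neg_roots hℓ ho h₂ h₃ h23 hx₂).le
  · rw [zero_pow (by omega)] at h₂
    linarith

theorem pos_of_three_roots (hℓ : 2 ≤ ℓ) (ho : Odd ℓ) (h₁ : x₁ ^ ℓ = b * x₁ + a)
    (h₂ : x₂ ^ ℓ = b * x₂ + a) (h₃ : x₃ ^ ℓ = b * x₃ + a) (h12 : x₂ < x₁) (h23 : x₃ < x₂) :
    0 < x₁ := by
  by_contra! hx₁
  exact (pow_lt_of_between hℓ (neg_nonneg.mpr hx₁) (neg_lt_neg h12) (neg_lt_neg h23)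
    (neg_pow_eq_of_odd ho h₁).le (neg_pow_eq_of_odd ho h₃).le).ne (neg_pow_eq_of_odd ho h₂)

theorem neg_le_of_three_roots (hℓ : 2 ≤ ℓ) (ho : Odd ℓ) (h₁ : x₁ ^ ℓ = b * x₁ + a)
    (h₂ : x₂ ^ ℓ = b * x₂ + a) (h₃ : x₃ ^ ℓ = b * x₃ + a) (h12 : x₂ < x₁) (h23 : x₃ < x₂)
    (hx₂ : x₂ ≤ 0) : -x₃ ≤ x₁ := by
  have ha := const_nonneg_of_nonpos_roots hℓ ho h₂ h₃ h23 hx₂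
  by_contra! hlt
  refine (pow_lt_of_between hℓ le_rfl (pos_of_three_roots hℓ ho h₁ h₂ h₃ h12 h23) hlt
    ?_ ?_).ne h₁
  · rw [zero_pow (by omega)]
    linarith
  · linarith [neg_pow_eq_of_odd ho h₃]

theorem neg_lt_of_three_roots (hℓ : 2 ≤ ℓ) (ho : Odd ℓ) (h₁ : x₁ ^ ℓ = b * x₁ + a)
    (h₂ : x₂ ^ ℓ = b * x₂ + a) (h₃ : x₃ ^ ℓ = b * x₃ + a) (h12 : x₂ < x₁) (h23 : x₃ < x₂)
    (hx₂ : x₂ < 0) : -x₃ < x₁ := by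
  refine (neg_le_of_three_roots hℓ ho h₁ h₂ h₃ h12 h23 hx₂.le).lt_of_ne ?_
  rintro rfl
  linarith [const_pos_of_neg_roots hℓ ho h₂ h₃ h23 hx₂, neg_pow_eq_of_odd ho h₃]

theorem add_add_nonpos_of_three_roots (hℓ : 2 ≤ ℓ) (ho : Odd ℓ) (h₁ : x₁ ^ ℓ = b * x₁ + a)
    (h₂ : x₂ ^ ℓ = b * x₂ + a) (h₃ : x₃ ^ ℓ = b * x₃ + a) (h23 : x₃ < x₂) (hx₂ : x₂ ≤ 0) :
    x₁ + x₂ + x₃ ≤ 0 := by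
  have ha := const_nonneg_of_nonpos_roots hℓ ho h₂ h₃ h23 hx₂
  by_contra! hlt
  have hbetween : (-x₂ + -x₃) ^ ℓ < b * (-x₂ + -x₃) + a := by
    refine pow_lt_of_between hℓ le_rfl (by linarith) (by linarith : _ < x₁) ?_ h₁.le
    rw [zero_pow (by omega)]
    linarith
  exact hbetween.not_ge <| add_pow_ge_of_pow_eq ho hℓ (by linarith) (by linarith)
    (neg_lt_neg h23).ne (neg_pow_eq_of_odd ho h₂) (neg_pow_eq_of_odd ho h₃)

theorem sum_ne_neg_one {p q : ℤ} (hle : x₁ ≤ 2) (h23 : x₃ < x₂) (hlt : -x₃ < x₁)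
    (hp : x₁ * x₂ + x₁ * x₃ + x₂ * x₃ = p) (hq : x₁ * x₂ * x₃ = q) : x₁ + x₂ + x₃ ≠ -1 := by
  intro hsum
  have hx₁ : x₁ = -x₂ - x₃ - 1 := by linarith
  have hint : (-x₂ - x₃) * ((-x₂ - 1) * (-x₃ - 1)) = (p + q : ℤ) := by
    push_cast
    rw [← hp, ← hq, hx₁]
    ring
  have hpos : 0 < (-x₂ - 1) * (-x₃ - 1) := mul_pos (by linarith) (by linarith)
  have hquarter : (-x₂ - 1) * (-x₃ - 1) ≤ 1 / 4 := by nlinarith [sq_nonneg (x₂ - x₃)]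
  have h₀ : ((0 : ℤ) : ℝ) < (p + q : ℤ) := by
    rw [← hint, Int.cast_zero]
    exact mul_pos (by linarith) hpos
  have h₁ : ((p + q : ℤ) : ℝ) < (1 : ℤ) := by
    rw [← hint, Int.cast_one]
    nlinarith
  have := Int.cast_lt.mp h₀
  have := Int.cast_lt.mp h₁
  omega

theorem sum_eq_zero_of_middle_nonpos (hℓ : 2 ≤ ℓ) (ho : Odd ℓ) (h₁ : x₁ ^ ℓ = b * x₁ + a)
    (h₂ : x₂ ^ ℓ = b * x₂ + a) (h₃ : x₃ ^ ℓ = b * x₃ + a) (h12 : x₂ < x₁) (h23 : x₃ < x₂)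
    (hx₂ : x₂ ≤ 0) (hle : x₁ ≤ 2) {p q r : ℤ} (hp : x₁ + x₂ + x₃ = p)
    (hq : x₁ * x₂ + x₁ * x₃ + x₂ * x₃ = q) (hr : x₁ * x₂ * x₃ = r) : x₁ + x₂ + x₃ = 0 := by
  have hneg := neg_le_of_three_roots hℓ ho h₁ h₂ h₃ h12 h23 hx₂
  have hp₀ : (p : ℝ) ≤ (0 : ℤ) := by
    simpa [hp] using add_add_nonpos_of_three_roots hℓ ho h₁ h₂ h₃ h23 hx₂
  have hp₂ : ((-2 : ℤ) : ℝ) < p := by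
    push_cast
    linarith
  have hp₁ : p ≠ -1 := by
    rintro rfl
    push_cast at hp
    exact sum_ne_neg_one hle h23
      (neg_lt_of_three_roots hℓ ho h₁ h₂ h₃ h12 h23 (by linarith)) hq hr hp
  have := Int.cast_le.mp hp₀
  have := Int.cast_lt.mp hp₂
  rw [hp, show p = 0 by omega, Int.cast_zero]

theorem sum_eq_zero_of_three_roots (hℓ : 2 ≤ ℓ) (h₁ : x₁ ^ ℓ = b * x₁ + a)
    (h₂ : x₂ ^ ℓ = b * x₂ + a) (h₃ : x₃ ^ ℓ = b * x₃ + a) (h12 : x₂ < x₁) (h23 : x₃ < x₂)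
    (hle : x₁ ≤ 2) (hge : -2 ≤ x₃) {p q r : ℤ} (hp : x₁ + x₂ + x₃ = p)
    (hq : x₁ * x₂ + x₁ * x₃ + x₂ * x₃ = q) (hr : x₁ * x₂ * x₃ = r) : x₁ + x₂ + x₃ = 0 := by
  have ho := odd_of_three_roots (by omega) h₁ h₂ h₃ h12 h23
  rcases le_total x₂ 0 with hx₂ | hx₂
  · exact sum_eq_zero_of_middle_nonpos hℓ ho h₁ h₂ h₃ h12 h23 hx₂ hle hp hq hr
  · have := sum_eq_zero_of_middle_nonpos hℓ ho (neg_pow_eq_of_odd ho h₃)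
      (neg_pow_eq_of_odd ho h₂) (neg_pow_eq_of_odd ho h₁) (neg_lt_neg h23) (neg_lt_neg h12)
      (neg_nonpos.mpr hx₂) (by linarith) (p := -p) (q := q) (r := -r)
      (by push_cast; linarith) (by linarith) (by push_cast; linarith)
    linarith

end Trinomial

section Cubic

open Polynomial in
theorem exists_root_of_traces {F K : Type*} [Field F] [Field K] [Algebra F K]
    {q r m₁ m₂ m₃ t₁ t₂ : F} {x₁ x₂ x₃ : K} (hsum : x₁ + x₂ + x₃ = 0)
    (hq : x₁ * x₂ + x₁ * x₃ + x₂ * x₃ = algebraMap F K q) (hr : x₁ * x₂ * x₃ = algebraMap F K r)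
    (ht₁ : algebraMap F K m₁ * x₁ + algebraMap F K m₂ * x₂ + algebraMap F K m₃ * x₃ =
      algebraMap F K t₁)
    (ht₂ : algebraMap F K m₁ * x₁ ^ 2 + algebraMap F K m₂ * x₂ ^ 2 + algebraMap F K m₃ * x₃ ^ 2 =
      algebraMap F K t₂) (ht₁₀ : t₁ ≠ 0) : ∃ s : F, s ^ 3 + q * s = r := by
  set P : F[X] := X ^ 3 + C q * X - C r with hP
  set Q : F[X] := C (m₂ + m₃ - 2 * m₁) * X ^ 2 + C t₁ * X + C (t₂ + (m₂ + m₃) * q) with hQ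
  have hPmonic : P.Monic := by rw [hP]; monicity!
  have hPdeg : P.natDegree = 3 := by rw [hP]; compute_degree!
  have hPx : aeval x₁ P = 0 := by
    simp only [hP, map_add, map_sub, map_mul, map_pow, aeval_X, aeval_C, ← hq, ← hr]
    linear_combination x₁ ^ 2 * hsum
  have hQx : aeval x₁ Q = 0 := by
    simp only [hQ, map_add, map_sub, map_mul, map_pow, aeval_X, aeval_C, ← hq, ← ht₁, ← ht₂,
      map_ofNat]
    linear_combination (algebraMap F K m₂ * (x₁ + x₂) + algebraMap F K m₃ * (x₁ + x₃)) * hsum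
  have hQ₀ : Q ≠ 0 := fun h => ht₁₀ (by
    simpa [hQ, -map_add, -map_sub, -map_mul] using congrArg (coeff · 1) h)
  by_contra! hroot
  have hirr : Irreducible P := by
    refine (hPmonic.irreducible_iff_roots_eq_zero_of_degree_le_three (by omega) (by omega)).mpr ?_
    refine Multiset.eq_zero_of_forall_notMem fun s hs => hroot s ?_
    have := isRoot_of_mem_roots hs
    simp only [hP, IsRoot.def, eval_add, eval_sub, eval_mul, eval_pow, eval_X, eval_C] at this
    linear_combination this
  have hdvd : P ∣ Q := by
    rw [minpoly.eq_of_irreducible_of_monic hirr hPx hPmonic]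
    exact minpoly.dvd F x₁ hQx
  have := natDegree_le_of_dvd hdvd hQ₀
  have : Q.natDegree ≤ 2 := natDegree_quadratic_le
  omega

theorem eq_and_eq_of_irrational {y : ℝ} (hy : Irrational y) {α β α' β' : ℤ}
    (h : α + β * y = α' + β' * y) : α = α' ∧ β = β' := by
  have hβ : β = β' := by
    by_contra hne
    have hne : (β : ℝ) - β' ≠ 0 := sub_ne_zero.mpr (by exact_mod_cast hne)
    refine hy ⟨(α' - α) / (β - β'), ?_⟩
    push_cast
    field_simp
    linear_combination -h
  subst hβ
  exact ⟨by exact_mod_cast add_right_cancel h, rfl⟩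

theorem abs_lt_of_irrational {y : ℝ} (hy : Irrational y) {n : ℤ} (h : |y| ≤ n) : |y| < n := by
  refine h.lt_of_ne fun hyn => ?_
  rcases eq_or_eq_neg_of_abs_eq hyn with rfl | rfl
  · exact n.not_irrational hy
  · exact n.not_irrational hy.of_neg

theorem eq_one_or_eq_neg_one_of_irrational {s u : ℤ} {y z : ℝ} (hsum : y + z = -s)
    (hmul : y * z = u) (hy : Irrational y) (hy₂ : |y| ≤ 2) (hz₂ : |z| ≤ 2) (hs : s ≠ 0) :
    (s = 1 ∨ s = -1) ∧ u = -1 := by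
  obtain rfl : z = (-s : ℤ) - y := by push_cast; linarith
  have hz : Irrational ((-s : ℤ) - y) := hy.intCast_sub _
  obtain ⟨hy₁, hy₂⟩ := abs_lt.mp (abs_lt_of_irrational hy (n := 2) hy₂)
  obtain ⟨hz₁, hz₂⟩ := abs_lt.mp (abs_lt_of_irrational hz (n := 2) hz₂)
  push_cast at hy₁ hy₂ hz₁ hz₂ hmul
  have hu₀ : u ≠ 0 := by
    rintro rfl
    exact mul_ne_zero hy.ne_zero hz.ne_zero (by simpa using hmul)
  have hs₁ : -4 < s := by exact_mod_cast (by linarith : (-4 : ℝ) < s)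
  have hs₂ : s < 4 := by exact_mod_cast (by linarith : (s : ℝ) < 4)
  have hplus : 0 < 4 + 2 * s + u := by
    have : (0 : ℝ) < 4 + 2 * s + u := by
      linear_combination mul_pos (sub_pos.mpr hy₂) (sub_pos.mpr hz₂) + hmul
    exact_mod_cast this
  have hminus : 0 < 4 - 2 * s + u := by
    have : (0 : ℝ) < 4 - 2 * s + u := by
      linear_combination mul_pos (sub_pos.mpr hy₁) (sub_pos.mpr hz₁) + hmul
    exact_mod_cast this
  have hdisc : 0 < s ^ 2 - 4 * u := by
    have hne : 2 * y + s ≠ 0 := fun h => hy ⟨-s / 2, by push_cast; linarith⟩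
    have : (0 : ℝ) < s ^ 2 - 4 * u := by
      linear_combination sq_pos_of_ne_zero hne - 4 * hmul
    exact_mod_cast this
  interval_cases s <;> omega

theorem not_irrational_of_traces {s u : ℤ} {y z : ℝ} (hsum : y + z = -s) (hmul : y * z = u)
    (hy₂ : |y| ≤ 2) (hz₂ : |z| ≤ 2) {D m₀ m₁ m₂ m₃ : ℕ} (h₀ : 0 < m₀) (h₁ : 0 < m₁) (h₂ : 0 < m₂)
    (ht₁ : m₀ * 2 + m₁ * s + m₂ * y + m₃ * z = 0)
    (ht₂ : D * (m₀ * 2 ^ 2 + m₁ * s ^ 2 + m₂ * y ^ 2 + m₃ * z ^ 2) = 4 * (m₀ + m₁ + m₂ + m₃ : ℝ)) :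
    ¬ Irrational y := by
  intro hy
  obtain rfl : z = -s - y := by linarith
  obtain ⟨hlin, hm⟩ := eq_and_eq_of_irrational hy (α := m₀ * 2 + m₁ * s - m₃ * s) (α' := 0)
    (β := m₂) (β' := m₃) (by push_cast; linear_combination ht₁)
  obtain rfl : m₂ = m₃ := by exact_mod_cast hm
  have hs : s ≠ 0 := by
    rintro rfl
    omega
  obtain ⟨hs₁, rfl⟩ := eq_one_or_eq_neg_one_of_irrational hsum hmul hy hy₂ hz₂ hs
  have hsq : D * (4 * m₀ + m₁ + 3 * m₂) = 4 * (m₀ + m₁ + 2 * m₂) := by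
    have hs₁ : (s : ℝ) ^ 2 = 1 := by rcases hs₁ with rfl | rfl <;> norm_num
    push_cast at hmul
    have : (D : ℝ) * (4 * m₀ + m₁ + 3 * m₂) = 4 * (m₀ + m₁ + 2 * m₂) := by
      linear_combination ht₂ - D * (m₁ + m₂) * hs₁ + 2 * D * m₂ * hmul
    exact_mod_cast this
  have hD : D < 3 := by
    by_contra!
    have := Nat.mul_le_mul_right (4 * m₀ + m₁ + 3 * m₂) this
    rcases hs₁ with rfl | rfl <;> omega
  interval_cases D <;> rcases hs₁ with rfl | rfl <;> omega

theorem exists_rat_root_of_traces {x₁ x₂ x₃ : ℝ} (hsum : x₁ + x₂ + x₃ = 0) {q r : ℤ}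
    (hq : x₁ * x₂ + x₁ * x₃ + x₂ * x₃ = q) (hr : x₁ * x₂ * x₃ = r) {D m₀ m₁ m₂ m₃ : ℕ}
    (h₀ : 0 < m₀) (ht₁ : m₀ * 2 + m₁ * x₁ + m₂ * x₂ + m₃ * x₃ = 0)
    (ht₂ : D * (m₀ * 2 ^ 2 + m₁ * x₁ ^ 2 + m₂ * x₂ ^ 2 + m₃ * x₃ ^ 2) =
      4 * (m₀ + m₁ + m₂ + m₃ : ℝ)) : ∃ s : ℚ, x₁ = s ∨ x₂ = s ∨ x₃ = s := by
  have hD : (D : ℝ) ≠ 0 := by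
    rintro h
    rw [h] at ht₂
    have : (0 : ℝ) < m₀ + m₁ + m₂ + m₃ := by positivity
    linarith
  obtain ⟨s, hs⟩ : ∃ s : ℚ, s ^ 3 + q * s = r := by
    refine exists_root_of_traces (m₁ := m₁) (m₂ := m₂) (m₃ := m₃) (t₁ := -(2 * m₀))
      (t₂ := 4 * (m₀ + m₁ + m₂ + m₃) / D - 4 * m₀) hsum (by simpa using hq) (by simpa using hr)
      ?_ ?_ (by simpa using h₀.ne')
    · simp only [map_neg, map_mul, map_natCast, map_ofNat]
      linear_combination ht₁
    · simp only [map_sub, map_div₀, map_mul, map_add, map_natCast, map_ofNat]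
      field_simp
      linear_combination ht₂
  have hroot : (x₁ - s) * ((x₂ - s) * (x₃ - s)) = 0 := by
    have : (s : ℝ) ^ 3 + q * s = r := by exact_mod_cast hs
    linear_combination s ^ 2 * hsum - s * hq + hr - this
  exact ⟨s, by simpa only [mul_eq_zero, sub_eq_zero] using hroot⟩

theorem exists_int_of_traces_of_rational {x y z : ℝ} {s : ℚ} (hx : x = s) (hxi : IsIntegral ℤ x)
    (hyi : IsIntegral ℤ y) (hsum : x + y + z = 0) {q : ℤ} (hq : x * y + x * z + y * z = q)
    (hy₂ : |y| ≤ 2) (hz₂ : |z| ≤ 2) {D m₀ m₁ m₂ m₃ : ℕ} (h₀ : 0 < m₀) (h₁ : 0 < m₁) (h₂ : 0 < m₂)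
    (ht₁ : m₀ * 2 + m₁ * x + m₂ * y + m₃ * z = 0)
    (ht₂ : D * (m₀ * 2 ^ 2 + m₁ * x ^ 2 + m₂ * y ^ 2 + m₃ * z ^ 2) = 4 * (m₀ + m₁ + m₂ + m₃ : ℝ)) :
    ∃ i j : ℤ, x = i ∧ y = j := by
  obtain ⟨i, rfl⟩ := exists_int_of_isIntegral hxi hx
  have hy : ¬ Irrational y := by
    refine not_irrational_of_traces (s := i) (u := q + i ^ 2) (by linarith) ?_ hy₂ hz₂ h₀ h₁ h₂
      ht₁ ht₂
    push_cast
    linear_combination hq - i * hsum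
  obtain ⟨t, ht⟩ := not_not.mp hy
  obtain ⟨j, rfl⟩ := exists_int_of_isIntegral hyi ht.symm
  exact ⟨i, j, rfl, rfl⟩

theorem exists_int_of_traces {x₁ x₂ x₃ : ℝ} (hx₁ : |x₁| ≤ 2) (hx₂ : |x₂| ≤ 2) (hx₃ : |x₃| ≤ 2)
    (hi₁ : IsIntegral ℤ x₁) (hi₂ : IsIntegral ℤ x₂) (hi₃ : IsIntegral ℤ x₃)
    (hsum : x₁ + x₂ + x₃ = 0) {q r : ℤ} (hq : x₁ * x₂ + x₁ * x₃ + x₂ * x₃ = q)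
    (hr : x₁ * x₂ * x₃ = r) {D m₀ m₁ m₂ m₃ : ℕ} (h₀ : 0 < m₀) (h₁ : 0 < m₁) (h₂ : 0 < m₂)
    (h₃ : 0 < m₃) (ht₁ : m₀ * 2 + m₁ * x₁ + m₂ * x₂ + m₃ * x₃ = 0)
    (ht₂ : D * (m₀ * 2 ^ 2 + m₁ * x₁ ^ 2 + m₂ * x₂ ^ 2 + m₃ * x₃ ^ 2) =
      4 * (m₀ + m₁ + m₂ + m₃ : ℝ)) : ∃ i j : ℤ, x₁ = i ∧ x₂ = j := by
  obtain ⟨s, hs | hs | hs⟩ := exists_rat_root_of_traces hsum hq hr h₀ ht₁ ht₂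
  · exact exists_int_of_traces_of_rational hs hi₁ hi₂ hsum hq hx₂ hx₃ h₀ h₁ h₂ ht₁ ht₂
  · obtain ⟨j, i, hj, hi⟩ := exists_int_of_traces_of_rational (z := x₃) (q := q) (D := D) (m₃ := m₃)
      hs hi₂ hi₁ (by linarith) (by linarith) hx₁ hx₃ h₀ h₂ h₁ (by linarith) (by linarith)
    exact ⟨i, j, hi, hj⟩
  · obtain ⟨k, i, hk, hi⟩ := exists_int_of_traces_of_rational (z := x₂) (q := q) (D := D) (m₃ := m₂)
      hs hi₃ hi₁ (by linarith) (by linarith) hx₁ hx₂ h₀ h₃ h₁ (by linarith) (by linarith)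
    exact ⟨i, -k - i, hi, by push_cast; linarith⟩

theorem eq_one_and_eq_zero_and_eq_neg_one {x₁ x₂ x₃ : ℝ} (h12 : x₂ < x₁) (h23 : x₃ < x₂)
    (hlt : x₁ < 2) (hge : -2 ≤ x₃) (hi₁ : IsIntegral ℤ x₁) (hi₂ : IsIntegral ℤ x₂)
    (hi₃ : IsIntegral ℤ x₃) (hsum : x₁ + x₂ + x₃ = 0) {q r : ℤ}
    (hq : x₁ * x₂ + x₁ * x₃ + x₂ * x₃ = q) (hr : x₁ * x₂ * x₃ = r) {D m₀ m₁ m₂ m₃ : ℕ}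
    (h₀ : 0 < m₀) (h₁ : 0 < m₁) (h₂ : 0 < m₂) (h₃ : 0 < m₃)
    (ht₁ : m₀ * 2 + m₁ * x₁ + m₂ * x₂ + m₃ * x₃ = 0)
    (ht₂ : D * (m₀ * 2 ^ 2 + m₁ * x₁ ^ 2 + m₂ * x₂ ^ 2 + m₃ * x₃ ^ 2) =
      4 * (m₀ + m₁ + m₂ + m₃ : ℝ)) : x₁ = 1 ∧ x₂ = 0 ∧ x₃ = -1 := by
  have habs {x : ℝ} (h : x₃ ≤ x) (h' : x ≤ x₁) : |x| ≤ 2 := abs_le.mpr ⟨by linarith, by linarith⟩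
  obtain ⟨i, j, rfl, rfl⟩ := exists_int_of_traces (habs (h23.le.trans h12.le) le_rfl)
    (habs h23.le h12.le) (habs le_rfl (h23.le.trans h12.le)) hi₁ hi₂ hi₃ hsum hq hr h₀ h₁ h₂ h₃
    ht₁ ht₂
  obtain rfl : x₃ = (-i - j : ℤ) := by push_cast; linarith
  norm_cast at h12 h23 hlt hge
  obtain ⟨rfl, rfl⟩ : i = 1 ∧ j = 0 := by omega
  norm_num

end Cubic

section Walk

variable {V : Type*} [Fintype V] [DecidableEq V] {G : SimpleGraph V} [DecidableRel G.Adj]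

theorem shift_mul_apply {ι : Type*} (M : Matrix G.Dart ι ℂ) (a : G.Dart) (i : ι) :
    (shift G * M) a i = M a.symm i := by
  simp [Matrix.mul_apply, shift, SimpleGraph.Dart.symm_involutive.eq_iff.symm]

theorem shift_mul_shift : shift G * shift G = 1 := by
  ext a b
  rw [shift_mul_apply]
  simp [shift, Matrix.one_apply, SimpleGraph.Dart.symm_involutive.injective.eq_iff]

omit [Fintype V] [DecidableRel G.Adj] in
theorem conjTranspose_shift : (shift G)ᴴ = shift G := by
  ext a b
  simp [shift, SimpleGraph.Dart.symm_involutive.eq_iff, eq_comm (a := b)]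

theorem shift_mem_unitary : shift G ∈ unitary (Matrix G.Dart G.Dart ℂ) := by
  rw [Unitary.mem_iff, Matrix.star_eq_conjTranspose, conjTranspose_shift]
  exact ⟨shift_mul_shift, shift_mul_shift⟩

theorem boundary_mul_shift_apply (x : V) (a : G.Dart) :
    (boundary G * shift G) x a = if x = a.fst then (1 / Real.sqrt (G.degree x) : ℂ) else 0 := by
  simp [Matrix.mul_apply, shift, boundary]

theorem boundary_mul_conjTranspose (hG : ∀ x, 0 < G.degree x) :
    boundary G * (boundary G)ᴴ = 1 := by
  have hfst : boundary G * (boundary G)ᴴ = boundary G * shift G * (boundary G * shift G)ᴴ := by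
    rw [Matrix.conjTranspose_mul, conjTranspose_shift, Matrix.mul_assoc,
      ← Matrix.mul_assoc (shift G), shift_mul_shift, Matrix.one_mul]
  ext x y
  rw [hfst, Matrix.mul_apply]
  simp only [Matrix.conjTranspose_apply, boundary_mul_shift_apply]
  obtain rfl | hxy := eq_or_ne x y
  · have hx : (G.degree x : ℂ) ≠ 0 := by exact_mod_cast (hG x).ne'
    have hterm : ∀ a : G.Dart, (if x = a.fst then (1 / Real.sqrt (G.degree x) : ℂ) else 0) *
        star (if x = a.fst then (1 / Real.sqrt (G.degree x) : ℂ) else 0) =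
        if a.fst = x then (G.degree x : ℂ)⁻¹ else 0 := fun a => by
      simp only [eq_comm (a := x)]
      split_ifs
      · simp [← mul_inv, ← Complex.ofReal_mul]
      · simp
    simp only [hterm, ← Finset.sum_filter, Finset.sum_const, G.dart_fst_fiber_card_eq_degree x,
      nsmul_eq_mul, mul_inv_cancel₀ hx, Matrix.one_apply_eq]
  · rw [Matrix.one_apply_ne hxy]
    refine Finset.sum_eq_zero fun a _ => ?_
    by_cases hx : x = a.fst
    · simp [← hx, hxy.symm]
    · simp [hx]

variable (G) in
/-- The discriminant `T = d R d*` of the Grover walk, on the vertices of `G`: the normalized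
adjacency matrix `T_{x,y} = A_{x,y} / √(deg x deg y)`. -/
noncomputable def discriminant : Matrix V V ℂ :=
  boundary G * shift G * (boundary G)ᴴ

theorem discriminant_apply (x y : V) : discriminant G x y =
    if G.Adj x y then (1 / (Real.sqrt (G.degree x) * Real.sqrt (G.degree y)) : ℂ) else 0 := by
  rw [discriminant, Matrix.mul_apply]
  simp only [Matrix.conjTranspose_apply, boundary_mul_shift_apply]
  simp only [boundary, Matrix.of_apply]
  split_ifs with hxy
  · rw [Finset.sum_eq_single ⟨(x, y), hxy⟩]
    · simp [mul_comm]
    · intro a _ ha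
      by_cases hx : x = a.fst
      · have hy : y ≠ a.snd := fun hy => ha (SimpleGraph.Dart.ext _ _ (Prod.ext hx.symm hy.symm))
        simp [hy]
      · simp [hx]
    · simp
  · refine Finset.sum_eq_zero fun a _ => ?_
    by_cases hx : x = a.fst
    · have hy : y ≠ a.snd := fun hy => hxy (hx ▸ hy ▸ a.adj)
      simp [hy]
    · simp [hx]

theorem timeEvolution_mem_unitary (hG : ∀ x, 0 < G.degree x) :
    timeEvolution G ∈ unitary (Matrix G.Dart G.Dart ℂ) := by
  have hproj : IsStarProjection ((boundary G)ᴴ * boundary G) :=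
    { isIdempotentElem := by
        rw [IsIdempotentElem, Matrix.mul_assoc, ← Matrix.mul_assoc (boundary G),
          boundary_mul_conjTranspose hG, Matrix.one_mul]
      isSelfAdjoint := Matrix.isHermitian_conjTranspose_mul_self _ }
  rw [timeEvolution, two_smul, ← two_mul]
  exact mul_mem shift_mem_unitary hproj.two_mul_sub_one_mem_unitary

theorem timeEvolution_mul_conjTranspose_boundary (hG : ∀ x, 0 < G.degree x) :
    timeEvolution G * (boundary G)ᴴ = shift G * (boundary G)ᴴ := by
  rw [timeEvolution, Matrix.mul_assoc, Matrix.sub_mul, Matrix.smul_mul,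
    Matrix.mul_assoc (boundary G)ᴴ, boundary_mul_conjTranspose hG, Matrix.mul_one,
    Matrix.one_mul, two_smul, add_sub_cancel_right]

theorem timeEvolution_mul_shift_mul_conjTranspose_boundary :
    timeEvolution G * (shift G * (boundary G)ᴴ) =
      (2 : ℂ) • (shift G * (boundary G)ᴴ * discriminant G) - (boundary G)ᴴ := by
  simp only [timeEvolution, discriminant, Matrix.mul_assoc, Matrix.sub_mul, Matrix.mul_sub,
    Matrix.smul_mul, Matrix.mul_smul, Matrix.one_mul]
  rw [← Matrix.mul_assoc (shift G) (shift G), shift_mul_shift, Matrix.one_mul]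

theorem mem_spectrum_timeEvolution_or (hG : ∀ x, 0 < G.degree x) {μ z w : ℂ}
    (hμ : μ ∈ spectrum ℂ (discriminant G)) (hmul : z * w = 1) (hadd : z + w = 2 * μ) :
    z ∈ spectrum ℂ (timeEvolution G) ∨ w ∈ spectrum ℂ (timeEvolution G) := by
  simp only [mem_spectrum_iff_exists_mulVec_eq_smul] at hμ ⊢
  obtain ⟨v, hv, hTv⟩ := hμ
  set f := (boundary G)ᴴ *ᵥ v with hf
  set g := (shift G * (boundary G)ᴴ) *ᵥ v with hg
  have hf₀ : f ≠ 0 := by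
    intro h
    have := congrArg (boundary G *ᵥ ·) h
    simp only [hf, Matrix.mulVec_mulVec, boundary_mul_conjTranspose hG, Matrix.one_mulVec,
      Matrix.mulVec_zero] at this
    exact hv this
  have hUf : timeEvolution G *ᵥ f = g := by
    rw [hf, hg, Matrix.mulVec_mulVec, timeEvolution_mul_conjTranspose_boundary hG]
  have hUg : timeEvolution G *ᵥ g = (2 * μ) • g - f := by
    rw [hf, hg, Matrix.mulVec_mulVec, timeEvolution_mul_shift_mul_conjTranspose_boundary,
      Matrix.sub_mulVec, Matrix.smul_mulVec, ← Matrix.mulVec_mulVec, hTv, Matrix.mulVec_smul,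
      smul_smul]
  by_cases hgf : g = w • f
  · exact Or.inr ⟨f, hf₀, hUf.trans hgf⟩
  · refine Or.inl ⟨g - w • f, sub_ne_zero.mpr hgf, ?_⟩
    rw [Matrix.mulVec_sub, Matrix.mulVec_smul, hUf, hUg, ← hadd, smul_sub, smul_smul, hmul]
    module

theorem sq_eq_one_or_exists_mem_spectrum_discriminant (hG : ∀ x, 0 < G.degree x) {z : ℂ}
    (hz : z ∈ spectrum ℂ (timeEvolution G)) :
    z ^ 2 = 1 ∨ ∃ μ ∈ spectrum ℂ (discriminant G), z ^ 2 + 1 = 2 * μ * z := by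
  obtain ⟨f, hf, hUf⟩ := mem_spectrum_iff_exists_mulVec_eq_smul.mp hz
  set v := boundary G *ᵥ f with hv
  set g := shift G *ᵥ f with hg
  have hRg : shift G *ᵥ g = f := by
    rw [hg, Matrix.mulVec_mulVec, shift_mul_shift, Matrix.one_mulVec]
  have hRU : (2 : ℂ) • ((boundary G)ᴴ *ᵥ v) - f = z • g := by
    rw [hg, ← Matrix.mulVec_smul (shift G), ← hUf, timeEvolution,
      Matrix.mulVec_mulVec f (shift G), ← Matrix.mul_assoc, shift_mul_shift, Matrix.one_mul,
      Matrix.sub_mulVec, Matrix.smul_mulVec, Matrix.one_mulVec, hv, Matrix.mulVec_mulVec]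
  by_cases hv₀ : v = 0
  · left
    rw [hv₀, Matrix.mulVec_zero, smul_zero, zero_sub] at hRU
    have hRf : -g = z • f := by rw [← hRg, ← Matrix.mulVec_smul, ← hRU, Matrix.mulVec_neg]
    have hsq : z ^ 2 • f = (1 : ℂ) • f := by
      rw [sq, mul_smul, ← hRf, smul_neg, ← hRU, neg_neg, one_smul]
    exact smul_left_injective ℂ hf hsq
  · right
    have hvg : v = z • (boundary G *ᵥ g) := by
      rw [← Matrix.mulVec_smul, ← hRU, Matrix.mulVec_sub, Matrix.mulVec_smul, Matrix.mulVec_mulVec,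
        boundary_mul_conjTranspose hG, Matrix.one_mulVec, ← hv, two_smul, add_sub_cancel_right]
    have hz₀ : z ≠ 0 := fun h => hv₀ (by rw [hvg, h, zero_smul])
    refine ⟨(z + z⁻¹) / 2, mem_spectrum_iff_exists_mulVec_eq_smul.mpr ⟨v, hv₀, ?_⟩, by field_simp⟩
    have hTv : (2 : ℂ) • (discriminant G *ᵥ v) - boundary G *ᵥ g = z • v := by
      have hdR := congrArg (fun h => boundary G *ᵥ (shift G *ᵥ h)) hRU
      rwa [Matrix.mulVec_smul, hRg, Matrix.mulVec_smul, ← hv, Matrix.mulVec_sub, ← hg,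
        Matrix.mulVec_sub, Matrix.mulVec_smul, Matrix.mulVec_smul, Matrix.mulVec_mulVec,
        Matrix.mulVec_mulVec, ← discriminant] at hdR
    have hg' : boundary G *ᵥ g = z⁻¹ • v := (eq_inv_smul_iff₀ hz₀).mpr hvg.symm
    rw [hg', sub_eq_iff_eq_add, ← add_smul] at hTv
    rw [div_eq_inv_mul, mul_smul, ← hTv, inv_smul_smul₀ two_ne_zero]

theorem isIntegral_two_mul_of_isPeriodic (hG : ∀ x, 0 < G.degree x) (hper : IsPeriodic G) {μ : ℂ}
    (hμ : μ ∈ spectrum ℂ (discriminant G)) : IsIntegral ℤ (2 * μ) := by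
  obtain ⟨τ, hτ, hU⟩ := hper
  obtain ⟨z, w, hmul, hadd⟩ := exists_mul_eq_one_and_add_eq (2 * μ)
  have hpow : z ^ τ = 1 ∧ w ^ τ = 1 := by
    have hzw : z ^ τ * w ^ τ = 1 := by rw [← mul_pow, hmul, one_pow]
    rcases mem_spectrum_timeEvolution_or hG hμ hmul hadd with hz | hw
    · have hz' := pow_eq_one_of_mem_spectrum hU hz
      exact ⟨hz', by simpa [hz'] using hzw⟩
    · have hw' := pow_eq_one_of_mem_spectrum hU hw
      exact ⟨by simpa [hw'] using hzw, hw'⟩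
  rw [← hadd]
  exact (IsIntegral.of_pow hτ (hpow.1 ▸ isIntegral_one)).add
    (IsIntegral.of_pow hτ (hpow.2 ▸ isIntegral_one))

open scoped Matrix.Norms.L2Operator in
theorem timeEvolution_pow_twelve_eq_one (hG : ∀ x, 0 < G.degree x)
    (hT : spectrum ℂ (discriminant G) ⊆ {1, 1 / 2, 0, -(1 / 2)}) : timeEvolution G ^ 12 = 1 := by
  have : IsStarNormal (timeEvolution G) :=
    isStarNormal_of_mem_unitary (timeEvolution_mem_unitary hG)
  refine pow_eq_one_of_forall_mem_spectrum _ fun z hz => ?_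
  rcases sq_eq_one_or_exists_mem_spectrum_discriminant hG hz with hsq | ⟨μ, hμ, hquad⟩
  · linear_combination (z ^ 10 + z ^ 8 + z ^ 6 + z ^ 4 + z ^ 2 + 1) * hsq
  · rcases hT hμ with rfl | rfl | rfl | rfl
    · have hsub : z - 1 = 0 := pow_eq_zero_iff two_ne_zero |>.mp (by linear_combination hquad)
      rw [sub_eq_zero.mp hsub, one_pow]
    · linear_combination (z ^ 6 + 1) * (z ^ 3 - 1) * (z + 1) * hquad
    · linear_combination (z ^ 8 + z ^ 4 + 1) * (z ^ 2 - 1) * hquad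
    · linear_combination (z ^ 9 + z ^ 6 + z ^ 3 + 1) * (z - 1) * hquad

end Walk

section AdjMatrix

variable {V : Type*} [Fintype V] {G : SimpleGraph V} [DecidableRel G.Adj]

theorem trace_adjMatrix_sq {R : Type*} [CommSemiring R] [DecidableEq V] {D : ℕ}
    (hreg : G.IsRegularOfDegree D) : (G.adjMatrix R ^ 2).trace = D * Fintype.card V := by
  simp only [sq, Matrix.trace, Matrix.diag_apply, SimpleGraph.adjMatrix_mul_self_apply_self,
    hreg.degree_eq, Finset.sum_const, Finset.card_univ, nsmul_eq_mul, mul_comm]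

theorem sum_adjMatrix_mulVec {R : Type*} [Semiring R] {D : ℕ} (hreg : G.IsRegularOfDegree D)
    (v : V → R) : ∑ x, (G.adjMatrix R *ᵥ v) x = D * ∑ x, v x := by
  have hone : (1 : V → R) ᵥ* G.adjMatrix R = (D : R) • 1 := by
    funext x
    simp [SimpleGraph.adjMatrix_vecMul_apply, hreg.degree_eq x]
  rw [← one_dotProduct, Matrix.dotProduct_mulVec, hone, smul_dotProduct, one_dotProduct,
    smul_eq_mul]

theorem sum_eq_zero_of_adjMatrix_mulVec_eq_smul {R : Type*} [Ring R] [IsDomain R] {D : ℕ}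
    (hreg : G.IsRegularOfDegree D) {v : V → R} {t : R} (hv : G.adjMatrix R *ᵥ v = t • v)
    (ht : t ≠ D) : ∑ x, v x = 0 := by
  have hsum := sum_adjMatrix_mulVec hreg v
  simp only [hv, Pi.smul_apply, smul_eq_mul, ← Finset.mul_sum] at hsum
  by_contra hne
  exact ht (mul_right_cancel₀ hne hsum)

theorem isRegularOfDegree_of_commute_ones {R : Type*} [Semiring R] [CharZero R]
    {J : Matrix V V R} (hJ : ∀ x y, J x y = 1) (h : Commute (G.adjMatrix R) J) (x : V) :
    G.IsRegularOfDegree (G.degree x) := by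
  intro y
  have hyx := congrFun (congrFun h.eq y) x
  rw [SimpleGraph.adjMatrix_mul_apply, SimpleGraph.mul_adjMatrix_apply] at hyx
  simpa [hJ] using hyx

theorem abs_le_of_mem_spectrum_adjMatrix [DecidableEq V] {D : ℕ} (hreg : G.IsRegularOfDegree D)
    {t : ℝ} (ht : t ∈ spectrum ℝ (G.adjMatrix ℝ)) : |t| ≤ D := by
  obtain ⟨v, hv, hAv⟩ := mem_spectrum_iff_exists_mulVec_eq_smul.mp ht
  obtain ⟨y, hy⟩ := Function.ne_iff.mp hv
  obtain ⟨x, -, hmax⟩ := Finset.exists_max_image Finset.univ (|v ·|) ⟨y, Finset.mem_univ y⟩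
  have hpos : 0 < |v x| := (abs_pos.mpr hy).trans_le (hmax y (Finset.mem_univ y))
  refine le_of_mul_le_mul_right ?_ hpos
  calc |t| * |v x| = |∑ z ∈ G.neighborFinset x, v z| := by
        rw [← abs_mul, ← smul_eq_mul, ← Pi.smul_apply, ← hAv, SimpleGraph.adjMatrix_mulVec_apply]
    _ ≤ ∑ z ∈ G.neighborFinset x, |v z| := Finset.abs_sum_le_sum_abs _ _
    _ ≤ (G.neighborFinset x).card • |v x| :=
        Finset.sum_le_card_nsmul _ _ _ fun z _ => hmax z (Finset.mem_univ z)
    _ = D * |v x| := by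
        rw [SimpleGraph.card_neighborFinset_eq_degree, hreg.degree_eq, nsmul_eq_mul]

theorem isGreatest_spectrum_adjMatrix [DecidableEq V] [Nonempty V] {D : ℕ}
    (hreg : G.IsRegularOfDegree D) : IsGreatest (spectrum ℝ (G.adjMatrix ℝ)) D := by
  refine ⟨mem_spectrum_iff_exists_mulVec_eq_smul.mpr ⟨1, one_ne_zero, ?_⟩, fun t ht =>
    (le_abs_self t).trans (abs_le_of_mem_spectrum_adjMatrix hreg ht)⟩
  funext x
  simp [SimpleGraph.adjMatrix_mulVec_apply, hreg.degree_eq x]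

variable [DecidableEq V]

theorem IsGenuineStronglyWalkRegular.exists_regular (hG : IsGenuineStronglyWalkRegular G) :
    ∃ D : ℕ, G.IsRegularOfDegree D ∧ ∃ (ℓ : ℕ) (a b : ℝ), 2 ≤ ℓ ∧
      ∀ t ∈ spectrum ℝ (G.adjMatrix ℝ), t ≠ D → t ^ ℓ = b * t + a := by
  obtain ⟨ℓ, hℓ, a, b, c, h⟩ := hG.stronglyWalkRegular
  set J : Matrix V V ℝ := Matrix.of fun _ _ => 1 with hJ
  have hc : c ≠ 0 := by
    rintro rfl
    have hfin := Set.finite_of_ncard_ne_zero (hG.four_eigenvalues.trans_ne four_ne_zero)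
    have hcard : hfin.toFinset.card ≤ 3 := card_le_three_of_forall_pow_eq hℓ fun t ht => by
      obtain ⟨v, hv, hAv⟩ :=
        mem_spectrum_iff_exists_mulVec_eq_smul.mp (hfin.mem_toFinset.mp ht)
      exact pow_eq_of_mulVec_eq_smul h hv hAv (by rw [zero_smul, Matrix.zero_mulVec])
    rw [← Set.ncard_eq_toFinset_card _ hfin, hG.four_eigenvalues] at hcard
    omega
  have hcomm : Commute (G.adjMatrix ℝ) J := by
    have hJ' : J = c⁻¹ • (G.adjMatrix ℝ ^ ℓ - (a • 1 + b • G.adjMatrix ℝ)) := by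
      rw [h, add_sub_cancel_left, inv_smul_smul₀ hc]
    rw [hJ']
    exact (((Commute.refl _).pow_right ℓ).sub_right
      (((Commute.one_right _).smul_right a).add_right ((Commute.refl _).smul_right b))).smul_right _
  obtain ⟨x⟩ := hG.connected.nonempty
  have hreg := isRegularOfDegree_of_commute_ones (fun _ _ => rfl) hcomm x
  refine ⟨G.degree x, hreg, ℓ, a, b, hℓ, fun t ht htD => ?_⟩
  obtain ⟨v, hv, hAv⟩ := mem_spectrum_iff_exists_mulVec_eq_smul.mp ht
  refine pow_eq_of_mulVec_eq_smul h hv hAv ?_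
  have hJv : J *ᵥ v = 0 := funext fun y => by
    simpa [hJ, Matrix.mulVec, dotProduct] using
      sum_eq_zero_of_adjMatrix_mulVec_eq_smul hreg hAv htD
  rw [Matrix.smul_mulVec, hJv, smul_zero]

end AdjMatrix

section RegularWalk

variable {V : Type*} [Fintype V] [DecidableEq V] {G : SimpleGraph V} [DecidableRel G.Adj] {D : ℕ}

theorem discriminant_eq_map (hreg : G.IsRegularOfDegree D) :
    discriminant G = ((D : ℝ)⁻¹ • G.adjMatrix ℝ).map (algebraMap ℝ ℂ) := by
  ext x y
  rw [discriminant_apply, hreg.degree_eq, hreg.degree_eq, ← Complex.ofReal_mul,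
    Real.mul_self_sqrt (Nat.cast_nonneg D)]
  by_cases hxy : G.Adj x y <;> simp [SimpleGraph.adjMatrix_apply, hxy]

theorem spectrum_discriminant (hreg : G.IsRegularOfDegree D) (hD : 0 < D) :
    spectrum ℂ (discriminant G) = (fun t : ℝ => (t / D : ℂ)) '' spectrum ℝ (G.adjMatrix ℝ) := by
  have hD' : (D : ℝ)⁻¹ ≠ 0 := by positivity
  have hherm : ((D : ℝ)⁻¹ • G.adjMatrix ℝ).IsHermitian := (G.isHermitian_adjMatrix ℝ).smul (.all _)
  rw [discriminant_eq_map hreg, spectrum_map_algebraMap hherm.splits_charpoly,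
    spectrum_smul_eq_image hD', Set.image_image]
  refine Set.image_congr fun t _ => ?_
  simp [div_eq_inv_mul]

theorem isIntegral_of_mem_spectrum_of_isPeriodic (hreg : G.IsRegularOfDegree D) (hD : 0 < D)
    (hper : IsPeriodic G) {t : ℝ} (ht : t ∈ spectrum ℝ (G.adjMatrix ℝ)) :
    IsIntegral ℤ (2 / D * t) := by
  have hdeg (x : V) : 0 < G.degree x := by rwa [hreg.degree_eq]
  have hμ : (t / D : ℂ) ∈ spectrum ℂ (discriminant G) := by
    rw [spectrum_discriminant hreg hD]
    exact Set.mem_image_of_mem _ ht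
  rw [← isIntegral_algebraMap_iff (algebraMap ℝ ℂ).injective]
  convert isIntegral_two_mul_of_isPeriodic hdeg hper hμ using 1
  simp only [Complex.coe_algebraMap]
  push_cast
  ring

theorem exists_int_symmetric_functions_of_spectrum {x₁ x₂ x₃ : ℝ} (h01 : x₁ < 2) (h12 : x₂ < x₁)
    (h23 : x₃ < x₂) (hspec : spectrum ℝ ((2 / D : ℝ) • G.adjMatrix ℝ) = {2, x₁, x₂, x₃})
    (hi₁ : IsIntegral ℤ x₁) (hi₂ : IsIntegral ℤ x₂) (hi₃ : IsIntegral ℤ x₃) :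
    ∃ p q r : ℤ, x₁ + x₂ + x₃ = p ∧ x₁ * x₂ + x₁ * x₃ + x₂ * x₃ = q ∧ x₁ * x₂ * x₃ = r := by
  have hmap : ((2 / D : ℚ) • G.adjMatrix ℚ).map (algebraMap ℚ ℝ) =
      (2 / D : ℝ) • G.adjMatrix ℝ := by
    ext x y
    by_cases hxy : G.Adj x y <;> simp [SimpleGraph.adjMatrix_apply, hxy]
  refine exists_int_symmetric_functions (M := (2 / D : ℚ) • G.adjMatrix ℚ) (d := 2) ?_
    (by exact_mod_cast h01) h12 h23 (by rw [hmap, hspec, Rat.cast_ofNat]) hi₁ hi₂ hi₃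
  rw [hmap]
  exact ((G.isHermitian_adjMatrix ℝ).smul (.all _)).splits_charpoly

theorem exists_multiplicities_of_spectrum (hreg : G.IsRegularOfDegree D) (hD : 0 < D)
    {x₁ x₂ x₃ : ℝ} (h01 : x₁ < 2) (h12 : x₂ < x₁) (h23 : x₃ < x₂)
    (hspec : spectrum ℝ ((2 / D : ℝ) • G.adjMatrix ℝ) = {2, x₁, x₂, x₃}) :
    ∃ m₀ m₁ m₂ m₃ : ℕ, 0 < m₀ ∧ 0 < m₁ ∧ 0 < m₂ ∧ 0 < m₃ ∧
      m₀ * 2 + m₁ * x₁ + m₂ * x₂ + m₃ * x₃ = 0 ∧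
      D * (m₀ * 2 ^ 2 + m₁ * x₁ ^ 2 + m₂ * x₂ ^ 2 + m₃ * x₃ ^ 2) =
        4 * (m₀ + m₁ + m₂ + m₃ : ℝ) := by
  have hD' : (D : ℝ) ≠ 0 := by positivity
  obtain ⟨m, hm, htrace⟩ := exists_trace_pow_eq_sum (S := {2, x₁, x₂, x₃})
    ((G.isHermitian_adjMatrix ℝ).smul (.all (2 / D : ℝ))) (by simpa using hspec)
  have hsum (j : ℕ) : (((2 / D : ℝ) • G.adjMatrix ℝ) ^ j).trace =
      m 2 * 2 ^ j + m x₁ * x₁ ^ j + m x₂ * x₂ ^ j + m x₃ * x₃ ^ j := by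
    rw [htrace, Finset.sum_insert (by grind), Finset.sum_insert (by grind),
      Finset.sum_insert (by grind), Finset.sum_singleton]
    ring
  have hsum₀ := hsum 0
  have hsum₁ := hsum 1
  have hsum₂ := hsum 2
  simp only [pow_zero, Matrix.trace_one, mul_one] at hsum₀
  simp only [pow_one, Matrix.trace_smul, SimpleGraph.trace_adjMatrix, smul_zero] at hsum₁
  rw [smul_pow, Matrix.trace_smul, trace_adjMatrix_sq hreg, smul_eq_mul] at hsum₂
  refine ⟨m 2, m x₁, m x₂, m x₃, hm _ (by simp), hm _ (by simp), hm _ (by simp), hm _ (by simp),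
    hsum₁.symm, ?_⟩
  rw [← hsum₀, ← hsum₂]
  field_simp
  ring

theorem mul_pow_eq_of_pow_eq {R : Type*} [CommSemiring R] {ℓ : ℕ} (hℓ : ℓ ≠ 0) {a b t : R} (s : R)
    (h : t ^ ℓ = b * t + a) : (s * t) ^ ℓ = s ^ (ℓ - 1) * b * (s * t) + s ^ ℓ * a := by
  rw [mul_pow, h, ← mul_pow_sub_one hℓ s]
  ring

theorem eigenvalues_smul_adjMatrix_eq_of_isIntegral (hreg : G.IsRegularOfDegree D) (hD : 0 < D)
    {x₁ x₂ x₃ : ℝ} (h01 : x₁ < 2) (h12 : x₂ < x₁) (h23 : x₃ < x₂) (hge : -2 ≤ x₃)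
    (hspec : spectrum ℝ ((2 / D : ℝ) • G.adjMatrix ℝ) = {2, x₁, x₂, x₃})
    (hi₁ : IsIntegral ℤ x₁) (hi₂ : IsIntegral ℤ x₂) (hi₃ : IsIntegral ℤ x₃) {ℓ : ℕ} {a b : ℝ}
    (hℓ : 2 ≤ ℓ) (hx₁ : x₁ ^ ℓ = b * x₁ + a) (hx₂ : x₂ ^ ℓ = b * x₂ + a)
    (hx₃ : x₃ ^ ℓ = b * x₃ + a) : x₁ = 1 ∧ x₂ = 0 ∧ x₃ = -1 := by
  obtain ⟨p, q, r, hp, hq, hr⟩ :=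
    exists_int_symmetric_functions_of_spectrum h01 h12 h23 hspec hi₁ hi₂ hi₃
  have hsum : x₁ + x₂ + x₃ = 0 :=
    sum_eq_zero_of_three_roots hℓ hx₁ hx₂ hx₃ h12 h23 h01.le hge hp hq hr
  obtain ⟨m₀, m₁, m₂, m₃, h₀, h₁, h₂, h₃, htrace₁, htrace₂⟩ :=
    exists_multiplicities_of_spectrum hreg hD h01 h12 h23 hspec
  exact eq_one_and_eq_zero_and_eq_neg_one h12 h23 h01 hge hi₁ hi₂ hi₃ hsum hq hr h₀ h₁ h₂ h₃
    htrace₁ htrace₂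

theorem eigenvalues_eq_of_isPeriodic (hreg : G.IsRegularOfDegree D) (hper : IsPeriodic G)
    {θ₁ θ₂ θ₃ : ℝ} (h01 : θ₁ < D) (h12 : θ₂ < θ₁) (h23 : θ₃ < θ₂)
    (hspec : spectrum ℝ (G.adjMatrix ℝ) = {(D : ℝ), θ₁, θ₂, θ₃}) {ℓ : ℕ} {a b : ℝ} (hℓ : 2 ≤ ℓ)
    (hroot : ∀ t ∈ spectrum ℝ (G.adjMatrix ℝ), t ≠ D → t ^ ℓ = b * t + a) :
    θ₁ = D / 2 ∧ θ₂ = 0 ∧ θ₃ = -(D / 2) := by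
  have mem₁ : θ₁ ∈ spectrum ℝ (G.adjMatrix ℝ) := by simp [hspec]
  have mem₂ : θ₂ ∈ spectrum ℝ (G.adjMatrix ℝ) := by simp [hspec]
  have mem₃ : θ₃ ∈ spectrum ℝ (G.adjMatrix ℝ) := by simp [hspec]
  have hθ₃ : -D ≤ θ₃ := (abs_le.mp (abs_le_of_mem_spectrum_adjMatrix hreg mem₃)).1
  have hD : (0 : ℝ) < D := by linarith
  set s : ℝ := 2 / D
  have hs : 0 < s := by positivity
  have hsD : s * D = 2 := div_mul_cancel₀ 2 hD.ne'
  have hspec' : spectrum ℝ (s • G.adjMatrix ℝ) = {2, s * θ₁, s * θ₂, s * θ₃} := by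
    simp only [spectrum_smul_eq_image hs.ne', hspec, Set.image_insert_eq, Set.image_singleton,
      hsD]
  have hint {t : ℝ} (ht : t ∈ spectrum ℝ (G.adjMatrix ℝ)) : IsIntegral ℤ (s * t) :=
    isIntegral_of_mem_spectrum_of_isPeriodic hreg (Nat.cast_pos.mp hD) hper ht
  have hpow {t : ℝ} (ht : t ∈ spectrum ℝ (G.adjMatrix ℝ)) (htD : t < D) :
      (s * t) ^ ℓ = s ^ (ℓ - 1) * b * (s * t) + s ^ ℓ * a :=
    mul_pow_eq_of_pow_eq (by omega) s (hroot t ht htD.ne)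
  have hge : -2 ≤ s * θ₃ := by
    rw [← hsD, ← mul_neg]
    exact mul_le_mul_of_nonneg_left hθ₃ hs.le
  obtain ⟨hx₁, hx₂, hx₃⟩ := eigenvalues_smul_adjMatrix_eq_of_isIntegral hreg (Nat.cast_pos.mp hD)
    (hsD ▸ mul_lt_mul_of_pos_left h01 hs) (mul_lt_mul_of_pos_left h12 hs)
    (mul_lt_mul_of_pos_left h23 hs) hge hspec' (hint mem₁) (hint mem₂) (hint mem₃) hℓ
    (hpow mem₁ h01) (hpow mem₂ (h12.trans h01)) (hpow mem₃ (h23.trans (h12.trans h01)))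
  exact ⟨mul_left_cancel₀ hs.ne' (by linarith), mul_left_cancel₀ hs.ne' (by linarith),
    mul_left_cancel₀ hs.ne' (by linarith)⟩

theorem timeEvolution_pow_twelve_eq_one_of_spectrum_adjMatrix (hreg : G.IsRegularOfDegree D)
    (hD : 0 < D)
    (hspec : spectrum ℝ (G.adjMatrix ℝ) = {(D : ℝ), (D / 2 : ℝ), 0, -(D / 2 : ℝ)}) :
    timeEvolution G ^ 12 = 1 := by
  have hD' : (D : ℂ) ≠ 0 := by exact_mod_cast hD.ne'
  refine timeEvolution_pow_twelve_eq_one (fun x => by rwa [hreg.degree_eq]) ?_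
  rw [spectrum_discriminant hreg hD, hspec]
  rintro _ ⟨t, rfl | rfl | rfl | rfl, rfl⟩
  · simp [hD']
  · simp [hD', div_right_comm]
  · simp
  · simp [hD', neg_div, div_right_comm]

end RegularWalk

end GroverWalk

/-- Here `k > θ₁ > θ₂ > θ₃` are the distinct eigenvalues of the adjacency matrix of `G`. -/
theorem mainTheorem5 {V : Type*} [Fintype V] [DecidableEq V]
    (G : SimpleGraph V) [DecidableRel G.Adj]
    (hG : GroverWalk.IsGenuineStronglyWalkRegular G)
    (k θ₁ θ₂ θ₃ : ℝ) (h₁ : θ₁ < k) (h₂ : θ₂ < θ₁) (h₃ : θ₃ < θ₂)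
    (hspec : spectrum ℝ (G.adjMatrix ℝ) = {k, θ₁, θ₂, θ₃}) :
    (GroverWalk.IsPeriodic G ↔ (θ₁, θ₂, θ₃) = (k / 2, 0, -(k / 2))) ∧
      ((θ₁, θ₂, θ₃) = (k / 2, 0, -(k / 2)) → GroverWalk.timeEvolution G ^ 12 = 1) := by
  obtain ⟨D, hreg, ℓ, a, b, hℓ, hroot⟩ := hG.exists_regular
  have : Nonempty V := hG.connected.nonempty
  obtain rfl : k = D := by
    refine IsGreatest.unique (s := spectrum ℝ (G.adjMatrix ℝ)) ⟨by simp [hspec], ?_⟩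
      (GroverWalk.isGreatest_spectrum_adjMatrix hreg)
    rw [hspec]
    rintro t (rfl | rfl | rfl | rfl) <;> linarith
  have hrev (h : (θ₁, θ₂, θ₃) = ((D : ℝ) / 2, (0 : ℝ), -((D : ℝ) / 2))) :
      GroverWalk.timeEvolution G ^ 12 = 1 := by
    simp only [Prod.mk.injEq] at h
    obtain ⟨rfl, rfl, rfl⟩ := h
    have hD : 0 < D := Nat.cast_pos.mp (show (0 : ℝ) < D by linarith)
    exact GroverWalk.timeEvolution_pow_twelve_eq_one_of_spectrum_adjMatrix hreg hD hspec
  refine ⟨⟨fun hper => ?_, fun h => ⟨12, by norm_num, hrev h⟩⟩, hrev⟩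
  obtain ⟨rfl, rfl, rfl⟩ :=
    GroverWalk.eigenvalues_eq_of_isPeriodic hreg hper h₁ h₂ h₃ hspec hℓ hroot
  rfl
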